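/- For a full-rank lattice $\Lambda\subseteq\mathbb R^2$ let $|\Lambda|=\min\{\|x\| : x\in\Lambda\setminus\{0\}\}$, where $\|\cdot\|$ is the Euclidean norm; $\Lambda$ is called well-rounded if the set $\{x\in\Lambda : \|x\|=|\Lambda|\}$ spans $\mathbb R^2$ over $\mathbb R$. For a positive integer $u$ let $\mathcal N(u)$ be the number of full-rank well-rounded sublattices of $\mathbb Z^2$ of determinant (area of a fundamental domain) equal to $u$. If $u=p_1p_2$, where $p_1<p_2$ are odd primes, then \[ \mathcal N(u)=\begin{cases} 0 & \text{if } p_1\equiv 3 \text{ or } p_2\equiv 3 \pmod 4, \text{ and } p_2>\sqrt3\,p_1,\\ 2 & \text{if } p_1\equiv 3 \text{ or } p_2\equiv 3 \pmod 4, \text{ and } p_2\le\sqrt3\,p_1,\\ 4 & \text{if } p_1\equiv p_2\equiv 1 \pmod 4 \text{ and } p_2>\sqrt3\,p_1,\\ 6 & \text{if } p_1\equiv p_2\equiv 1 \pmod 4 \text{ and } p_2\le\sqrt3\,p_1. \end{cases} \] -/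

import Mathlib

namespace WellRounded

/-- The minimum `|Λ|` of a lattice `Λ ⊆ ℝᴺ`: the least Euclidean norm of a nonzero vector of `Λ`
(the infimum is attained when `Λ` is discrete and nonzero). -/
noncomputable def minimum {N : ℕ} (Λ : Submodule ℤ (EuclideanSpace ℝ (Fin N))) : ℝ :=
  sInf {r : ℝ | ∃ x ∈ Λ, x ≠ 0 ∧ ‖x‖ = r}

/-- The set `S(Λ)` of minimal vectors of `Λ`. -/
def minimalVectors {N : ℕ} (Λ : Submodule ℤ (EuclideanSpace ℝ (Fin N))) :
    Set (EuclideanSpace ℝ (Fin N)) :=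
  {x | x ∈ Λ ∧ ‖x‖ = minimum Λ}

/-- `Λ` is well-rounded if its minimal vectors span `ℝᴺ`. -/
def IsWellRounded {N : ℕ} (Λ : Submodule ℤ (EuclideanSpace ℝ (Fin N))) : Prop :=
  Submodule.span ℝ (minimalVectors Λ) = ⊤

/-- The integer lattice `ℤᴺ` in Euclidean space. -/
def integerLattice (N : ℕ) : Submodule ℤ (EuclideanSpace ℝ (Fin N)) :=
  Submodule.span ℤ (Set.range (EuclideanSpace.basisFun (Fin N) ℝ))

/-- `WR(Ω)`: the set of all full-rank well-rounded sublattices of the lattice `Ω`. -/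
def WR {N : ℕ} (Ω : Submodule ℤ (EuclideanSpace ℝ (Fin N))) :
    Set (Submodule ℤ (EuclideanSpace ℝ (Fin N))) :=
  {Λ | Λ ≤ Ω ∧ Submodule.span ℝ (Λ : Set (EuclideanSpace ℝ (Fin N))) = ⊤ ∧ IsWellRounded Λ}

/-- `𝒩(u)`: the number (a priori possibly infinite) of lattices in `WR(ℤ²)` of determinant `u`,
the determinant of a full-rank lattice being the area of a fundamental domain. -/
noncomputable def numWR (u : ℕ) : ℕ∞ :=
  Set.encard {Λ | Λ ∈ WR (integerLattice 2) ∧ ZLattice.covolume Λ = (u : ℝ)}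

end WellRounded

/-! Work in `GaussianInt`. A well-rounded lattice has a basis of two minimal vectors `z`, `w` of
equal norm (`exists_basis_of_isWellRounded`), so `z + w` and `z - w` are orthogonal: `z + w = s * G`
and `z - w = i * k * G` with `G` primitive. If the area is odd, then `s` and `k` are odd and `G = (1
+ i) * g`, which gives `u = |s * k| * g.norm` (`exists_primitive_decomposition`). The angle
condition becomes `s ^ 2 ≤ 3 * k ^ 2` and `k ^ 2 ≤ 3 * s ^ 2`.

For `u = p * q` with odd primes `p < q`, these bounds leave two possibilities
(`factorization_cases`). Either `|s| = |k| = 1`, and the lattice is the ideal generated by `g`, of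
norm `p * q`; or `{|s|, |k|} = {p, q}` and `g` is a unit, which gives two rhombic lattices with
diagonals along `1 + i` and `1 - i`, present exactly when `q ≤ √3 * p`. By unique factorization
there are four ideals of norm `p * q` if both primes split, and none if one is inert. The two
families are disjoint, so the counts add up. -/

namespace WellRounded

/-! ### The integer lattice as the Gaussian integers. -/

/-- The embedding of the Gaussian integers in the Euclidean plane. -/
noncomputable def gaussianEmbed : GaussianInt →ₗ[ℤ] EuclideanSpace ℝ (Fin 2) :=
  AddMonoidHom.toIntLinearMap
    { toFun := fun z => !₂[(z.re : ℝ), (z.im : ℝ)]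
      map_zero' := by ext i; fin_cases i <;> simp
      map_add' := fun z w => by ext i; fin_cases i <;> simp }

@[simp] theorem gaussianEmbed_zero_apply (z : GaussianInt) : gaussianEmbed z 0 = z.re := rfl

@[simp] theorem gaussianEmbed_one_apply (z : GaussianInt) : gaussianEmbed z 1 = z.im := rfl

theorem gaussianEmbed_injective : Function.Injective gaussianEmbed := by
  intro z w h
  have h0 := congrArg (fun v : EuclideanSpace ℝ (Fin 2) => v 0) h
  have h1 := congrArg (fun v : EuclideanSpace ℝ (Fin 2) => v 1) h
  simp only [gaussianEmbed_zero_apply, gaussianEmbed_one_apply, Int.cast_inj] at h0 h1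
  exact Zsqrtd.ext h0 h1

theorem norm_gaussianEmbed (z : GaussianInt) : ‖gaussianEmbed z‖ = √(z.norm : ℝ) := by
  rw [EuclideanSpace.norm_eq, Fin.sum_univ_two]
  simp [Zsqrtd.norm_def, sq]

theorem range_gaussianEmbed : LinearMap.range gaussianEmbed = integerLattice 2 := by
  apply le_antisymm
  · rintro _ ⟨z, rfl⟩
    have h : gaussianEmbed z = z.re • EuclideanSpace.basisFun (Fin 2) ℝ 0
        + z.im • EuclideanSpace.basisFun (Fin 2) ℝ 1 := by
      ext i; fin_cases i <;> simp
    rw [h]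
    exact add_mem (Submodule.smul_mem _ _ (Submodule.subset_span ⟨0, rfl⟩))
      (Submodule.smul_mem _ _ (Submodule.subset_span ⟨1, rfl⟩))
  · rw [integerLattice, Submodule.span_le]
    rintro _ ⟨i, rfl⟩
    fin_cases i
    · exact ⟨⟨1, 0⟩, by ext i; fin_cases i <;> simp⟩
    · exact ⟨⟨0, 1⟩, by ext i; fin_cases i <;> simp⟩

/-! ### Reduction theory for pairs of vectors of equal norm. -/

/-- The oriented area of the parallelogram spanned by two Gaussian integers. -/
def area (z w : GaussianInt) : ℤ := z.re * w.im - z.im * w.re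

/-- The Euclidean inner product of two Gaussian integers. -/
def dot (z w : GaussianInt) : ℤ := z.re * w.re + z.im * w.im

/-- `M` has a basis of two vectors of equal length, enclosing an angle between `π / 3` and
`2 * π / 3`, that span a parallelogram of area `u`. -/
def HasEquilateralBasis (u : ℕ) (M : Submodule ℤ GaussianInt) : Prop :=
  ∃ z w : GaussianInt, M = Submodule.span ℤ {z, w} ∧ z.norm = w.norm ∧
    2 * |dot z w| ≤ z.norm ∧ |area z w| = u

theorem norm_smul_add_smul (a b : ℤ) (z w : GaussianInt) :
    (a • z + b • w).norm = a ^ 2 * z.norm + 2 * a * b * dot z w + b ^ 2 * w.norm := by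
  simp only [Zsqrtd.norm_def, dot, zsmul_eq_mul, Zsqrtd.re_add, Zsqrtd.im_add, Zsqrtd.re_smul,
    Zsqrtd.im_smul]
  ring

/-- The angle bound reduces the quadratic form to `a ^ 2 - |a * b| + b ^ 2` times `z.norm`, and this
factor is a positive integer unless `a = b = 0`. -/
theorem norm_le_norm_smul_add_smul {z w : GaussianInt} (h : z.norm = w.norm)
    (hd : 2 * |dot z w| ≤ z.norm) {a b : ℤ} (hab : a ≠ 0 ∨ b ≠ 0) :
    z.norm ≤ (a • z + b • w).norm := by
  rw [norm_smul_add_smul, ← h]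
  have hn : 0 ≤ z.norm := GaussianInt.norm_nonneg z
  have h1 : -(|a| * |b| * z.norm) ≤ 2 * a * b * dot z w := by
    have h2 : |2 * a * b * dot z w| = |a| * |b| * (2 * |dot z w|) := by
      simp only [abs_mul, abs_two]; ring
    have h3 := neg_abs_le (2 * a * b * dot z w)
    have h4 : |a| * |b| * (2 * |dot z w|) ≤ |a| * |b| * z.norm := by gcongr
    linarith
  have h5 : 1 ≤ a ^ 2 - |a| * |b| + b ^ 2 := by
    rw [← sq_abs a, ← sq_abs b]
    have ha := abs_nonneg a
    have hb := abs_nonneg b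
    rcases hab with h | h
    · have : 0 < |a| := abs_pos.2 h
      rcases eq_or_ne (|a|) (|b|) with e | e
      · rw [← e]; nlinarith
      · have : 0 < (|a| - |b|) ^ 2 := by have := sub_ne_zero.2 e; positivity
        nlinarith [mul_nonneg ha hb]
    · have : 0 < |b| := abs_pos.2 h
      rcases eq_or_ne (|a|) (|b|) with e | e
      · rw [e]; nlinarith
      · have : 0 < (|a| - |b|) ^ 2 := by have := sub_ne_zero.2 e; positivity
        nlinarith [mul_nonneg ha hb]
  nlinarith [mul_le_mul_of_nonneg_right h5 hn]

theorem exists_two_mul_abs_sub_mul_le (A D : ℤ) (hD : D ≠ 0) :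
    ∃ a : ℤ, 2 * |A - a * D| ≤ |D| := by
  refine ⟨round ((A : ℚ) / D), ?_⟩
  have h := abs_sub_round ((A : ℚ) / D)
  have hD' : (D : ℚ) ≠ 0 := by exact_mod_cast hD
  have h1 : (A : ℚ) - round ((A : ℚ) / D) * D = (A / D - round ((A : ℚ) / D)) * D := by
    field_simp
  have h2 : 2 * |(A : ℚ) - round ((A : ℚ) / D) * D| ≤ |(D : ℚ)| := by
    rw [h1, abs_mul]
    nlinarith [abs_nonneg (D : ℚ)]
  exact_mod_cast h2

/-- Neither `z + w` nor `z - w` is shorter than `z`; expanding their norms gives the two bounds. -/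
theorem two_mul_abs_dot_le {M : Submodule ℤ GaussianInt} {z w : GaussianInt} (hz : z ∈ M)
    (hw : w ∈ M) (h : z.norm = w.norm) (hM : ∀ v ∈ M, v ≠ 0 → z.norm ≤ v.norm)
    (hzw : area z w ≠ 0) : 2 * |dot z w| ≤ z.norm := by
  have h1 := hM (z + w) (add_mem hz hw) (by
    intro e; apply hzw
    obtain rfl : w = -z := by rw [eq_neg_iff_add_eq_zero, add_comm]; exact e
    simp [area]; ring)
  have h2 := hM (z - w) (sub_mem hz hw) (by
    intro e; apply hzw
    obtain rfl : z = w := sub_eq_zero.1 e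
    simp [area]; ring)
  have e1 := norm_smul_add_smul 1 1 z w
  have e2 := norm_smul_add_smul 1 (-1) z w
  simp only [one_smul, neg_smul, ← sub_eq_add_neg] at e1 e2
  rw [← abs_two, ← abs_mul, abs_le]
  constructor <;> linarith

/-- Round the coordinates of `v` in the real basis `z`, `w`. The remainder has coordinates at most
`1 / 2` in absolute value, hence norm at most `3 / 4` of the minimum, so it vanishes. -/
theorem eq_span_pair_of_forall_norm_le {M : Submodule ℤ GaussianInt} {z w : GaussianInt}
    (hz : z ∈ M) (hw : w ∈ M) (h : z.norm = w.norm) (hM : ∀ v ∈ M, v ≠ 0 → z.norm ≤ v.norm)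
    (hzw : area z w ≠ 0) : M = Submodule.span ℤ {z, w} := by
  have hd := two_mul_abs_dot_le hz hw h hM hzw
  apply le_antisymm
  · intro v hv
    obtain ⟨a, ha⟩ := exists_two_mul_abs_sub_mul_le (area v w) (area z w) hzw
    obtain ⟨b, hb⟩ := exists_two_mul_abs_sub_mul_le (area z v) (area z w) hzw
    set A := area v w - a * area z w with hA
    set B := area z v - b * area z w with hB
    set D := area z w with hD
    -- Cramer's rule, with the denominator `D` cleared.
    have hr : D • (v - (a • z + b • w)) = A • z + B • w := by
      simp only [hA, hB, hD, area]
      ext <;> simp <;> ring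
    have hN := norm_smul_add_smul A B z w
    rw [← hr, ← h, zsmul_eq_mul, Zsqrtd.norm_mul, Zsqrtd.norm_intCast] at hN
    have hn : 0 ≤ z.norm := GaussianInt.norm_nonneg z
    have hpos : 0 < z.norm := GaussianInt.norm_pos.2 (by rintro rfl; simp [hD, area] at hzw)
    have hA2 : 4 * A ^ 2 ≤ D ^ 2 := by
      rw [← sq_abs A, ← sq_abs D]; nlinarith [abs_nonneg A]
    have hB2 : 4 * B ^ 2 ≤ D ^ 2 := by
      rw [← sq_abs B, ← sq_abs D]; nlinarith [abs_nonneg B]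
    have hAB : 4 * (|A| * |B|) ≤ D ^ 2 := by
      nlinarith [sq_nonneg (|A| - |B|), sq_abs A, sq_abs B]
    have hc : 2 * A * B * dot z w ≤ |A| * |B| * z.norm := by
      have h2 : |2 * A * B * dot z w| = |A| * |B| * (2 * |dot z w|) := by
        simp only [abs_mul, abs_two]; ring
      calc _ ≤ |2 * A * B * dot z w| := le_abs_self _
        _ ≤ _ := by rw [h2]; gcongr
    have hD2 : 0 < D ^ 2 := by positivity
    have hlt : (v - (a • z + b • w)).norm < z.norm := by
      by_contra! hge
      nlinarith [mul_le_mul_of_nonneg_right hA2 hn, mul_le_mul_of_nonneg_right hB2 hn,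
        mul_le_mul_of_nonneg_right hAB hn, mul_le_mul_of_nonneg_left hge hD2.le, mul_pos hD2 hpos]
    have hmem : a • z + b • w ∈ M := add_mem (M.smul_mem a hz) (M.smul_mem b hw)
    have h0 : v - (a • z + b • w) = 0 := by
      by_contra hne
      exact absurd (hM _ (sub_mem hv hmem) hne) (not_le.2 hlt)
    rw [sub_eq_zero.1 h0]
    exact Submodule.mem_span_pair.2 ⟨a, b, rfl⟩
  · rw [Submodule.span_le]
    rintro _ (rfl | rfl) <;> assumption

/-! ### From Euclidean lattices to submodules of the Gaussian integers. -/

theorem linearIndependent_gaussianEmbed {z w : GaussianInt} (h : area z w ≠ 0) :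
    LinearIndependent ℝ ![gaussianEmbed z, gaussianEmbed w] := by
  rw [LinearIndependent.pair_iff]
  intro s t e
  have h0 := congrArg (fun v : EuclideanSpace ℝ (Fin 2) => v 0) e
  have h1 := congrArg (fun v : EuclideanSpace ℝ (Fin 2) => v 1) e
  simp [-GaussianInt.intCast_re, -GaussianInt.intCast_im] at h0 h1
  have hD : ((z.re : ℝ) * w.im - z.im * w.re) ≠ 0 := by exact_mod_cast h
  constructor
  · refine (mul_eq_zero.1 (?_ : s * ((z.re : ℝ) * w.im - z.im * w.re) = 0)).resolve_right hD
    linear_combination w.im * h0 - w.re * h1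
  · refine (mul_eq_zero.1 (?_ : t * ((z.re : ℝ) * w.im - z.im * w.re) = 0)).resolve_right hD
    linear_combination z.re * h1 - z.im * h0

/-- The basis of the Euclidean plane given by two Gaussian integers. -/
noncomputable def planeBasis {z w : GaussianInt} (h : area z w ≠ 0) :
    Module.Basis (Fin 2) ℝ (EuclideanSpace ℝ (Fin 2)) :=
  basisOfLinearIndependentOfCardEqFinrank (linearIndependent_gaussianEmbed h) (by simp)

theorem coe_planeBasis {z w : GaussianInt} (h : area z w ≠ 0) :
    ⇑(planeBasis h) = ![gaussianEmbed z, gaussianEmbed w] := by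
  simp [planeBasis]

theorem map_span_pair {z w : GaussianInt} (h : area z w ≠ 0) :
    (Submodule.span ℤ {z, w}).map gaussianEmbed =
      Submodule.span ℤ (Set.range (planeBasis h)) := by
  rw [Submodule.map_span, coe_planeBasis, Matrix.range_cons_cons_empty, Set.image_pair]

theorem covolume_map_span_pair {z w : GaussianInt} (h : area z w ≠ 0) :
    ZLattice.covolume ((Submodule.span ℤ {z, w}).map gaussianEmbed) = |(area z w : ℝ)| := by
  rw [map_span_pair h]
  rw [ZLattice.covolume_eq_measure_fundamentalDomain _ _
    (ZSpan.isAddFundamentalDomain (planeBasis h) MeasureTheory.volume)]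
  rw [ZSpan.measureReal_fundamentalDomain _ _ (EuclideanSpace.basisFun (Fin 2) ℝ).toBasis]
  rw [MeasureTheory.measureReal_congr (ZSpan.fundamentalDomain_ae_parallelepiped _ _)]
  rw [MeasureTheory.measureReal_def]
  rw [OrthonormalBasis.coe_toBasis, OrthonormalBasis.volume_parallelepiped]
  rw [Module.Basis.det_apply, coe_planeBasis, Matrix.det_fin_two]
  simp [Module.Basis.toMatrix_apply, area]
  ring_nf

/-- A spanning set does not lie in the kernel of a nonzero linear functional. -/
theorem exists_mem_apply_ne_zero_of_span_eq_top {S : Set (EuclideanSpace ℝ (Fin 2))}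
    (hS : Submodule.span ℝ S = ⊤) {a b : ℝ} (hab : a ≠ 0 ∨ b ≠ 0) :
    ∃ v ∈ S, a * v 0 + b * v 1 ≠ 0 := by
  by_contra! hcon
  have h : ∀ v : EuclideanSpace ℝ (Fin 2), a * v 0 + b * v 1 = 0 := by
    intro v
    have hv : v ∈ Submodule.span ℝ S := hS ▸ Submodule.mem_top
    induction hv using Submodule.span_induction with
    | mem x hx => exact hcon x hx
    | zero => simp
    | add x y _ _ hx hy =>
      simp only [PiLp.add_apply]
      linear_combination hx + hy
    | smul c x _ hx =>
      simp only [PiLp.smul_apply, smul_eq_mul]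
      linear_combination c * hx
  have h0 := h !₂[1, 0]
  have h1 := h !₂[0, 1]
  simp at h0 h1
  tauto

theorem norm_eq_of_norm_gaussianEmbed_eq {z w : GaussianInt}
    (h : ‖gaussianEmbed z‖ = ‖gaussianEmbed w‖) : z.norm = w.norm := by
  rw [norm_gaussianEmbed, norm_gaussianEmbed, Real.sqrt_inj
    (by exact_mod_cast GaussianInt.norm_nonneg z) (by exact_mod_cast GaussianInt.norm_nonneg w)] at h
  exact_mod_cast h

theorem minimum_le {N : ℕ} {Λ : Submodule ℤ (EuclideanSpace ℝ (Fin N))}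
    {x : EuclideanSpace ℝ (Fin N)} (hx : x ∈ Λ) (h : x ≠ 0) : minimum Λ ≤ ‖x‖ :=
  csInf_le ⟨0, by rintro _ ⟨y, -, -, rfl⟩; exact norm_nonneg y⟩ ⟨x, hx, h, rfl⟩

theorem exists_basis_of_isWellRounded {M : Submodule ℤ GaussianInt}
    (hM : IsWellRounded (M.map gaussianEmbed)) :
    ∃ z w : GaussianInt, M = Submodule.span ℤ {z, w} ∧ z.norm = w.norm ∧
      2 * |dot z w| ≤ z.norm ∧ area z w ≠ 0 := by
  obtain ⟨_, ⟨⟨z, hz, rfl⟩, hzm⟩, hz0⟩ :=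
    exists_mem_apply_ne_zero_of_span_eq_top hM (a := 1) (b := 0) (by simp)
  have hz0' : z.re ≠ 0 := by
    rintro h; apply hz0; simp [-GaussianInt.intCast_re, -GaussianInt.intCast_im, h]
  -- The functional is now `area z`; it is nonzero because `z` was chosen with nonzero real part.
  obtain ⟨_, ⟨⟨w, hw, rfl⟩, hwm⟩, hw0⟩ :=
    exists_mem_apply_ne_zero_of_span_eq_top hM (a := -z.im) (b := z.re)
      (Or.inr (by exact_mod_cast hz0'))
  have hzw : area z w ≠ 0 := by
    intro h
    apply hw0
    simp only [gaussianEmbed_zero_apply, gaussianEmbed_one_apply]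
    have : ((area z w : ℤ) : ℝ) = 0 := by exact_mod_cast h
    simp only [area] at this
    push_cast at this
    linear_combination this
  have hn : z.norm = w.norm := norm_eq_of_norm_gaussianEmbed_eq (hzm.trans hwm.symm)
  have hmin : ∀ v ∈ M, v ≠ 0 → z.norm ≤ v.norm := by
    intro v hv hv0
    have h := minimum_le (Submodule.mem_map_of_mem (f := gaussianEmbed) hv)
      ((map_ne_zero_iff _ gaussianEmbed_injective).2 hv0)
    rw [← hzm, norm_gaussianEmbed, norm_gaussianEmbed, Real.sqrt_le_sqrt_iff
      (by exact_mod_cast GaussianInt.norm_nonneg v)] at h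
    exact_mod_cast h
  exact ⟨z, w, eq_span_pair_of_forall_norm_le hz hw hn hmin hzw, hn,
    two_mul_abs_dot_le hz hw hn hmin hzw, hzw⟩

theorem map_gaussianEmbed_mem_WR {z w : GaussianInt} (hn : z.norm = w.norm)
    (hd : 2 * |dot z w| ≤ z.norm) (hzw : area z w ≠ 0) :
    (Submodule.span ℤ {z, w}).map gaussianEmbed ∈ WR (integerLattice 2) := by
  have hz : z ∈ Submodule.span ℤ {z, w} := Submodule.subset_span (by simp)
  have hw : w ∈ Submodule.span ℤ {z, w} := Submodule.subset_span (by simp)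
  have hz0 : z ≠ 0 := by rintro rfl; simp [area] at hzw
  have hmin : minimum ((Submodule.span ℤ {z, w}).map gaussianEmbed) = ‖gaussianEmbed z‖ := by
    apply le_antisymm
    · exact minimum_le (Submodule.mem_map_of_mem hz)
        ((map_ne_zero_iff _ gaussianEmbed_injective).2 hz0)
    · apply le_csInf
      · exact ⟨_, _, Submodule.mem_map_of_mem hz,
          (map_ne_zero_iff _ gaussianEmbed_injective).2 hz0, rfl⟩
      · rintro _ ⟨_, ⟨v, hv, rfl⟩, hv0, rfl⟩
        obtain ⟨a, b, rfl⟩ := Submodule.mem_span_pair.1 hv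
        have hab : a ≠ 0 ∨ b ≠ 0 := by
          by_contra! h
          simp [h.1, h.2] at hv0
        rw [norm_gaussianEmbed, norm_gaussianEmbed]
        exact Real.sqrt_le_sqrt (by exact_mod_cast norm_le_norm_smul_add_smul hn hd hab)
  have hwr : IsWellRounded ((Submodule.span ℤ {z, w}).map gaussianEmbed) := by
    rw [IsWellRounded, eq_top_iff, ← (planeBasis hzw).span_eq, Submodule.span_le, coe_planeBasis]
    rintro _ ⟨i, rfl⟩
    apply Submodule.subset_span
    fin_cases i
    · exact ⟨Submodule.mem_map_of_mem hz, hmin.symm⟩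
    · refine ⟨Submodule.mem_map_of_mem hw, ?_⟩
      rw [hmin]
      simp [norm_gaussianEmbed, hn]
  refine ⟨?_, ?_, hwr⟩
  · rw [← range_gaussianEmbed]
    exact LinearMap.map_le_range
  · rw [eq_top_iff, ← hwr]
    exact Submodule.span_mono fun x hx => hx.1

theorem setOf_WR_covolume_eq_image {u : ℕ} (hu : u ≠ 0) :
    {Λ | Λ ∈ WR (integerLattice 2) ∧ ZLattice.covolume Λ = (u : ℝ)} =
      Submodule.map gaussianEmbed '' {M | HasEquilateralBasis u M} := by
  ext Λ
  constructor
  · rintro ⟨⟨hle, -, hwr⟩, hcov⟩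
    rw [← range_gaussianEmbed] at hle
    obtain ⟨M, rfl⟩ : ∃ M : Submodule ℤ GaussianInt, M.map gaussianEmbed = Λ :=
      ⟨Λ.comap gaussianEmbed, Submodule.map_comap_eq_of_le hle⟩
    obtain ⟨z, w, rfl, hn, hd, hzw⟩ := exists_basis_of_isWellRounded hwr
    rw [covolume_map_span_pair hzw] at hcov
    exact ⟨_, ⟨z, w, rfl, hn, hd, by exact_mod_cast hcov⟩, rfl⟩
  · rintro ⟨_, ⟨z, w, rfl, hn, hd, hzw⟩, rfl⟩
    have h0 : area z w ≠ 0 := by rw [← abs_pos, hzw]; positivity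
    refine ⟨map_gaussianEmbed_mem_WR hn hd h0, ?_⟩
    rw [covolume_map_span_pair h0]
    exact_mod_cast hzw

theorem numWR_eq_encard {u : ℕ} (hu : u ≠ 0) :
    numWR u = {M | HasEquilateralBasis u M}.encard := by
  rw [numWR, setOf_WR_covolume_eq_image hu,
    (Submodule.map_injective_of_injective gaussianEmbed_injective).encard_image]

/-! ### The square and the rhombic lattices. -/

/-- By Cramer's rule the coordinates of `v` in the basis `z`, `w` are quotients of areas by `area z
w`, hence integers. -/
theorem eq_span_pair_of_dvd_area {M : Submodule ℤ GaussianInt} {D : ℤ} (hD : D ≠ 0)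
    (hM : ∀ v ∈ M, ∀ w ∈ M, D ∣ area v w) {z w : GaussianInt} (hz : z ∈ M) (hw : w ∈ M)
    (hzw : |area z w| = |D|) : M = Submodule.span ℤ {z, w} := by
  have hdvd : area z w ∣ D := abs_dvd_abs _ _ |>.1 (dvd_of_eq hzw)
  have hne : area z w ≠ 0 := by rintro h; rw [h, abs_zero, eq_comm, abs_eq_zero] at hzw; exact hD hzw
  apply le_antisymm
  · intro v hv
    obtain ⟨a, ha⟩ := hdvd.trans (hM v hv w hw)
    obtain ⟨b, hb⟩ := hdvd.trans (hM z hz v hv)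
    refine Submodule.mem_span_pair.2 ⟨a, b, ?_⟩
    have h1 : area z w * (a * z.re + b * w.re) = area z w * v.re := by
      simp only [area] at ha hb ⊢
      linear_combination (-z.re) * ha - w.re * hb
    have h2 : area z w * (a * z.im + b * w.im) = area z w * v.im := by
      simp only [area] at ha hb ⊢
      linear_combination (-z.im) * ha - w.im * hb
    ext
    · simpa using mul_left_cancel₀ hne h1
    · simpa using mul_left_cancel₀ hne h2
  · rw [Submodule.span_le]
    rintro _ (rfl | rfl) <;> assumption

/-- The square lattice of all multiples of the Gaussian integer `g`. -/
def principalLattice (g : GaussianInt) : Submodule ℤ GaussianInt :=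
  (Ideal.span {g}).restrictScalars ℤ

theorem mem_principalLattice {g x : GaussianInt} : x ∈ principalLattice g ↔ g ∣ x := by
  rw [principalLattice, Submodule.restrictScalars_mem, Ideal.mem_span_singleton]

/-- The lattice of all `x + y * i` with `s ∣ x + y` and `k ∣ x - y`. -/
def diagonalLattice (s k : ℤ) : Submodule ℤ GaussianInt where
  carrier := {v | s ∣ v.re + v.im ∧ k ∣ v.re - v.im}
  zero_mem' := by simp
  add_mem' := by
    rintro a b ⟨h1, h2⟩ ⟨h3, h4⟩
    refine ⟨?_, ?_⟩
    · rw [Zsqrtd.re_add, Zsqrtd.im_add, add_add_add_comm]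
      exact dvd_add h1 h3
    · rw [Zsqrtd.re_add, Zsqrtd.im_add, add_sub_add_comm]
      exact dvd_add h2 h4
  smul_mem' := by
    rintro c a ⟨h1, h2⟩
    refine ⟨?_, ?_⟩
    · rw [zsmul_eq_mul, Zsqrtd.re_smul, Zsqrtd.im_smul, ← mul_add]
      exact h1.mul_left c
    · rw [zsmul_eq_mul, Zsqrtd.re_smul, Zsqrtd.im_smul, ← mul_sub]
      exact h2.mul_left c

theorem mem_diagonalLattice {s k : ℤ} {v : GaussianInt} :
    v ∈ diagonalLattice s k ↔ s ∣ v.re + v.im ∧ k ∣ v.re - v.im := Iff.rfl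

theorem dvd_area_of_mem_principalLattice {g v w : GaussianInt} (hv : v ∈ principalLattice g)
    (hw : w ∈ principalLattice g) : g.norm ∣ area v w := by
  rw [mem_principalLattice] at hv hw
  obtain ⟨a, rfl⟩ := hv
  obtain ⟨b, rfl⟩ := hw
  refine ⟨area a b, ?_⟩
  simp only [area, Zsqrtd.norm_def, Zsqrtd.re_mul, Zsqrtd.im_mul]
  ring

/-- Passing to the coordinates `x + y`, `x - y` doubles areas up to sign; the factor 2 is cancelled
since `s * k` is odd. -/
theorem dvd_area_of_mem_diagonalLattice {s k : ℤ} (hs : Odd s) (hk : Odd k) {v w : GaussianInt}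
    (hv : v ∈ diagonalLattice s k) (hw : w ∈ diagonalLattice s k) : s * k ∣ area v w := by
  obtain ⟨⟨a, ha⟩, ⟨b, hb⟩⟩ := hv
  obtain ⟨⟨c, hc⟩, ⟨d, hd⟩⟩ := hw
  have hcop : IsCoprime (s * k) 2 := (Int.isCoprime_two_right).2 (hs.mul hk)
  refine hcop.dvd_of_dvd_mul_left ⟨b * c - a * d, ?_⟩
  simp only [area]
  have e : 2 * (v.re * w.im - v.im * w.re) =
    (v.re - v.im) * (w.re + w.im) - (v.re + v.im) * (w.re - w.im) := by ring
  rw [e, ha, hb, hc, hd]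
  ring

theorem hasEquilateralBasis_principalLattice {u : ℕ} (hu : u ≠ 0) {g : GaussianInt}
    (hg : g.norm = u) : HasEquilateralBasis u (principalLattice g) := by
  have harea : area g (⟨0, 1⟩ * g) = g.norm := by simp [area, Zsqrtd.norm_def]
  refine ⟨g, ⟨0, 1⟩ * g, ?_, ?_, ?_, ?_⟩
  · refine eq_span_pair_of_dvd_area (D := g.norm) (by rw [hg]; exact_mod_cast hu)
      (fun v hv w hw => dvd_area_of_mem_principalLattice hv hw)
      (mem_principalLattice.2 dvd_rfl) (mem_principalLattice.2 (dvd_mul_left _ _)) ?_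
    rw [harea]
  · simp [Zsqrtd.norm_def]; ring
  · have : dot g (⟨0, 1⟩ * g) = 0 := by simp [dot]; ring
    rw [this]
    simpa using GaussianInt.norm_nonneg g
  · rw [harea, hg]; simp

/-- The basis is `e + f * i`, `f + e * i` with `e = (s - k) / 2` and `f = (s + k) / 2`: a rhombus
with diagonals `s * (1 + i)` and `k * (1 - i)` up to sign. -/
theorem hasEquilateralBasis_diagonalLattice {s k : ℕ} (hs : Odd s) (hk : Odd k)
    (h1 : s ^ 2 ≤ 3 * k ^ 2) (h2 : k ^ 2 ≤ 3 * s ^ 2) :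
    HasEquilateralBasis (s * k) (diagonalLattice s k) := by
  have hs' : Odd (s : ℤ) := by exact_mod_cast hs
  have hk' : Odd (k : ℤ) := by exact_mod_cast hk
  obtain ⟨f, hf⟩ := hs'.add_odd hk'
  obtain ⟨e, he⟩ := hs'.sub_odd hk'
  have hS : (s : ℤ) = e + f := by lia
  have hK : (k : ℤ) = f - e := by lia
  have harea : |area ⟨e, f⟩ ⟨f, e⟩| = (s : ℤ) * k := by
    rw [show area ⟨e, f⟩ ⟨f, e⟩ = -((s : ℤ) * k) by rw [hS, hK]; simp only [area]; ring, abs_neg]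
    exact abs_of_nonneg (by positivity)
  refine ⟨⟨e, f⟩, ⟨f, e⟩, ?_, ?_, ?_, ?_⟩
  · refine eq_span_pair_of_dvd_area (D := s * k) (mul_ne_zero ?_ ?_)
      (fun v hv w hw => dvd_area_of_mem_diagonalLattice hs' hk' hv hw) ?_ ?_ ?_
    · rintro h; simp [h] at hs'
    · rintro h; simp [h] at hk'
    · rw [mem_diagonalLattice]
      exact ⟨⟨1, by linarith⟩, ⟨-1, by linarith⟩⟩
    · rw [mem_diagonalLattice]
      exact ⟨⟨1, by linarith⟩, ⟨1, by linarith⟩⟩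
    · rw [harea, abs_of_nonneg (by positivity)]
  · simp [Zsqrtd.norm_def]; ring
  · zify at h1 h2
    rw [hS, hK] at h1 h2
    simp only [dot, Zsqrtd.norm_def]
    rw [← abs_two, ← abs_mul, abs_le]
    constructor <;> linarith
  · rw [harea]; push_cast; rfl

/-! ### Classification of the lattices of determinant `p * q`. -/

/-- The four equations are the real and imaginary parts of `(1 - i) * z = (s + i * k) * g` and `(1 -
i) * w = (s - i * k) * g`. -/
theorem exists_primitive_decomposition {z w : GaussianInt} (hn : z.norm = w.norm)
    (hodd : Odd (area z w)) :
    ∃ (s k : ℤ) (g : GaussianInt), Odd s ∧ Odd k ∧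
      z.re + z.im = s * g.re - k * g.im ∧ z.re - z.im = -(s * g.im) - k * g.re ∧
      w.re + w.im = s * g.re + k * g.im ∧ w.re - w.im = -(s * g.im) + k * g.re := by
  have hne : z + w ≠ 0 := by
    intro e
    obtain rfl : w = -z := by rw [eq_neg_iff_add_eq_zero, add_comm]; exact e
    have : area z (-z) = 0 := by simp [area]; ring
    simp [this] at hodd
  obtain ⟨g, hg, hcop⟩ := Zsqrtd.exists_coprime_of_gcd_pos ((Zsqrtd.gcd_pos_iff _).2 hne)
  generalize ((Int.gcd (z + w).re (z + w).im : ℕ) : ℤ) = s at hg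
  have hre : z.re + w.re = s * g.re := by simpa using congrArg Zsqrtd.re hg
  have him : z.im + w.im = s * g.im := by simpa using congrArg Zsqrtd.im hg
  have hs0 : s ≠ 0 := by
    rintro rfl
    apply hne
    simpa using hg
  -- Equal norms make `z + w` and `z - w` orthogonal. As `g` is primitive, `z - w` is then an
  -- integer multiple of `i * g`, and the Bézout coefficients produce the factor `k`.
  have horth : g.re * (z.re - w.re) + g.im * (z.im - w.im) = 0 := by
    apply mul_left_cancel₀ hs0
    simp only [Zsqrtd.norm_def] at hn
    linear_combination hn - (z.re - w.re) * hre - (z.im - w.im) * him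
  obtain ⟨a, b, hab⟩ := hcop
  obtain ⟨k, hk⟩ : ∃ k, k = a * (z.im - w.im) - b * (z.re - w.re) := ⟨_, rfl⟩
  have hk1 : z.im - w.im = k * g.re := by
    rw [hk]; linear_combination (-(z.im - w.im)) * hab + b * horth
  have hk2 : z.re - w.re = -(k * g.im) := by
    rw [hk]; linear_combination (-(z.re - w.re)) * hab + a * horth
  have harea : 2 * area z w = -(s * k * (g.re * g.re + g.im * g.im)) := by
    simp only [area]
    linear_combination (z.re - w.re) * him - (z.im - w.im) * hre + s * g.im * hk2 - s * g.re * hk1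
  have hdvd4 : ¬ (4 : ℤ) ∣ 2 * area z w := by
    rintro ⟨c, hc⟩
    obtain ⟨d, hd⟩ := hodd
    lia
  have hz1 : 2 * z.re = s * g.re - k * g.im := by linarith
  have hz2 : 2 * z.im = s * g.im + k * g.re := by linarith
  -- `(s + i * k) * g = 2 * z` with `g` primitive, so `s` and `k` have the same parity; both even
  -- would give `4 ∣ 2 * area z w`.
  have hk_of_s : Even s → Even k := by
    rintro ⟨c, rfl⟩
    refine ⟨a * (z.im - c * g.im) + b * (c * g.re - z.re), ?_⟩
    linear_combination (-k) * hab - a * hz2 + b * hz1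
  have hs_of_k : Even k → Even s := by
    rintro ⟨c, rfl⟩
    refine ⟨a * (z.re + c * g.im) + b * (z.im - c * g.re), ?_⟩
    linear_combination (-s) * hab - a * hz1 - b * hz2
  have hnot : ¬ (Even s ∧ Even k) := by
    rintro ⟨⟨c, rfl⟩, ⟨d, rfl⟩⟩
    apply hdvd4
    rw [harea]
    exact ⟨-(c * d * (g.re * g.re + g.im * g.im)), by ring⟩
  have hs : Odd s := by rw [← Int.not_even_iff_odd]; exact fun h => hnot ⟨h, hk_of_s h⟩
  have hk' : Odd k := by rw [← Int.not_even_iff_odd]; exact fun h => hnot ⟨hs_of_k h, h⟩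
  have hpar : Even (g.re + g.im) := by
    have h : Even (s * g.re - k * g.im) := ⟨z.re, by linarith⟩
    simp only [Int.even_sub, Int.even_mul, Int.not_even_iff_odd.2 hs, Int.not_even_iff_odd.2 hk',
      false_or] at h
    rwa [Int.even_add]
  obtain ⟨x, hx⟩ := hpar
  have him' : g.im = x + x - g.re := by linarith
  rw [him'] at hz1 hk2 hz2
  -- The new witness is the old `g` divided by `1 + i`.
  refine ⟨s, k, ⟨x, x - g.re⟩, hs, hk', ?_, ?_, ?_, ?_⟩ <;> dsimp only <;> linarith

/-- A unit `g` is real or purely imaginary; the imaginary case swaps the roles of `s` and `k`. -/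
theorem eq_diagonalLattice_of_norm_eq_one {s k : ℤ} {z w g : GaussianInt} (hs : Odd s)
    (hk : Odd k) (hg : g.norm = 1) (hzw : |area z w| = |s * k|)
    (h1 : z.re + z.im = s * g.re - k * g.im) (h2 : z.re - z.im = -(s * g.im) - k * g.re)
    (h3 : w.re + w.im = s * g.re + k * g.im) (h4 : w.re - w.im = -(s * g.im) + k * g.re) :
    diagonalLattice s k = Submodule.span ℤ {z, w} ∨
      diagonalLattice k s = Submodule.span ℤ {z, w} := by
  have hs0 : s ≠ 0 := by rintro rfl; simp at hs
  have hk0 : k ≠ 0 := by rintro rfl; simp at hk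
  have hcases : g.im = 0 ∨ g.re = 0 := by
    rw [Zsqrtd.norm_def] at hg
    by_contra! h
    have := mul_self_pos.2 h.1
    have := mul_self_pos.2 h.2
    linarith
  rcases hcases with h | h <;> simp only [h, mul_zero, sub_zero, add_zero, zero_sub, zero_add,
    neg_zero] at h1 h2 h3 h4
  · left
    refine eq_span_pair_of_dvd_area (mul_ne_zero hs0 hk0)
      (fun v hv w hw => dvd_area_of_mem_diagonalLattice hs hk hv hw) ?_ ?_ hzw
    · rw [mem_diagonalLattice, h1, h2]
      exact ⟨dvd_mul_right _ _, (dvd_mul_right _ _).neg_right⟩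
    · rw [mem_diagonalLattice, h3, h4]
      exact ⟨dvd_mul_right _ _, dvd_mul_right _ _⟩
  · right
    refine eq_span_pair_of_dvd_area (mul_ne_zero hk0 hs0)
      (fun v hv w hw => dvd_area_of_mem_diagonalLattice hk hs hv hw) ?_ ?_ (by rwa [mul_comm k])
    · rw [mem_diagonalLattice, h1, h2]
      exact ⟨(dvd_mul_right _ _).neg_right, (dvd_mul_right _ _).neg_right⟩
    · rw [mem_diagonalLattice, h3, h4]
      exact ⟨dvd_mul_right _ _, (dvd_mul_right _ _).neg_right⟩

theorem diagonalLattice_natAbs (s k : ℤ) :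
    diagonalLattice s.natAbs k.natAbs = diagonalLattice s k := by
  ext v
  simp only [mem_diagonalLattice, Int.natCast_natAbs, abs_dvd]

/-- Here `s ± i * k` is a unit times `1 - i`, so `z` and `w` are unit multiples of `g`. -/
theorem eq_principalLattice_of_abs_eq_one {s k : ℤ} {z w g : GaussianInt} (hs : s.natAbs = 1)
    (hk : k.natAbs = 1) (hg : g ≠ 0) (hzw : |area z w| = |g.norm|)
    (h1 : z.re + z.im = s * g.re - k * g.im) (h2 : z.re - z.im = -(s * g.im) - k * g.re)
    (h3 : w.re + w.im = s * g.re + k * g.im) (h4 : w.re - w.im = -(s * g.im) + k * g.re) :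
    principalLattice g = Submodule.span ℤ {z, w} := by
  have hdvd : g ∣ z ∧ g ∣ w := by
    rcases Int.natAbs_eq s with hs' | hs' <;> rcases Int.natAbs_eq k with hk' | hk' <;>
      rw [hs] at hs' <;> rw [hk] at hk' <;> subst hs' hk' <;> push_cast at h1 h2 h3 h4
    · exact ⟨⟨⟨0, 1⟩, by ext <;> simp <;> lia⟩, ⟨1, by ext <;> simp <;> lia⟩⟩
    · exact ⟨⟨1, by ext <;> simp <;> lia⟩, ⟨⟨0, 1⟩, by ext <;> simp <;> lia⟩⟩
    · exact ⟨⟨-1, by ext <;> simp <;> lia⟩, ⟨⟨0, -1⟩, by ext <;> simp <;> lia⟩⟩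
    · exact ⟨⟨⟨0, -1⟩, by ext <;> simp <;> lia⟩, ⟨-1, by ext <;> simp <;> lia⟩⟩
  exact eq_span_pair_of_dvd_area (GaussianInt.norm_pos.2 hg).ne'
    (fun v hv w hw => dvd_area_of_mem_principalLattice hv hw) (mem_principalLattice.2 hdvd.1)
    (mem_principalLattice.2 hdvd.2) hzw

/-- The ratio of `s` and `k` is at most `√3`, so if one of them is 1 the other cannot reach 3. -/
theorem factorization_cases {p q s k n : ℕ} (hp : p.Prime) (hq : q.Prime) (hp2 : 3 ≤ p)
    (hq2 : 3 ≤ q) (h : s * k * n = p * q) (h1 : s ^ 2 ≤ 3 * k ^ 2) (h2 : k ^ 2 ≤ 3 * s ^ 2) :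
    (s = 1 ∧ k = 1 ∧ n = p * q) ∨ (s = p ∧ k = q ∧ n = 1) ∨ (s = q ∧ k = p ∧ n = 1) := by
  obtain ⟨a, b, ha, hb, hab⟩ := Nat.dvd_mul.1 (⟨k * n, by rw [← h, mul_assoc]⟩ : s ∣ p * q)
  have key : ∀ {r t : ℕ}, t.Prime → 3 ≤ r → k * n = t → r ^ 2 ≤ 3 * k ^ 2 → k = t ∧ n = 1 := by
    intro r t ht hr hkn hle
    rcases (Nat.dvd_prime ht).1 ⟨n, hkn.symm⟩ with rfl | rfl
    · nlinarith
    · exact ⟨rfl, by have := ht.pos; nlinarith⟩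
  rcases (Nat.dvd_prime hp).1 ha with rfl | rfl <;> rcases (Nat.dvd_prime hq).1 hb with rfl | rfl
  · left
    obtain rfl : s = 1 := by lia
    have hk : k ≤ 1 := by nlinarith
    have hk0 : k ≠ 0 := by rintro rfl; simp at h1
    obtain rfl : k = 1 := by lia
    exact ⟨rfl, rfl, by lia⟩
  · right; right
    obtain rfl : s = b := by lia
    have := key hp hq2 (mul_left_cancel₀ (by lia : s ≠ 0) (by rw [← mul_assoc, h, mul_comm])) h1
    exact ⟨rfl, this⟩
  · right; left
    obtain rfl : s = a := by lia
    have := key hq hp2 (mul_left_cancel₀ (by lia : s ≠ 0) (by rw [← mul_assoc, h])) h1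
    exact ⟨rfl, this⟩
  · exfalso
    subst hab
    have hkn : k * n = 1 := by
      apply mul_left_cancel₀ (by positivity : a * b ≠ 0)
      rw [← mul_assoc, h, mul_one]
    obtain rfl : k = 1 := Nat.eq_one_of_mul_eq_one_right hkn
    nlinarith [Nat.mul_le_mul hp2 hq2]

theorem hasEquilateralBasis_prime_mul_prime_iff {p q : ℕ} (hp : p.Prime) (hq : q.Prime)
    (hp2 : Odd p) (hq2 : Odd q) (hpq : p ≤ q) (M : Submodule ℤ GaussianInt) :
    HasEquilateralBasis (p * q) M ↔
      (∃ g : GaussianInt, g.norm = (p * q : ℕ) ∧ M = principalLattice g) ∨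
      (q ^ 2 ≤ 3 * p ^ 2 ∧ (M = diagonalLattice p q ∨ M = diagonalLattice q p)) := by
  have hle : p ^ 2 ≤ 3 * q ^ 2 := by nlinarith
  have hne : p * q ≠ 0 := mul_ne_zero hp.ne_zero hq.ne_zero
  constructor
  · rintro ⟨z, w, rfl, hn, hd, hu⟩
    have hodd : Odd (area z w) := by
      rw [← odd_abs, hu]
      exact_mod_cast hp2.mul hq2
    obtain ⟨s, k, g, hs, hk, h1, h2, h3, h4⟩ := exists_primitive_decomposition hn hodd
    have harea : area z w = -(s * k * g.norm) := by
      have : 2 * area z w = 2 * (-(s * k * g.norm)) := by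
        have e : 2 * area z w =
          (z.re - z.im) * (w.re + w.im) - (z.re + z.im) * (w.re - w.im) := by
          simp only [area]; ring
        rw [e, h1, h2, h3, h4, Zsqrtd.norm_def]
        ring
      linarith
    have hg : 0 < g.norm := GaussianInt.norm_pos.2 (by
      rintro rfl
      rw [harea] at hodd
      simp at hodd)
    have hnorm : 2 * z.norm = g.norm * (s ^ 2 + k ^ 2) := by
      have e : 2 * z.norm = (z.re + z.im) ^ 2 + (z.re - z.im) ^ 2 := by
        rw [Zsqrtd.norm_def]; ring
      rw [e, h1, h2, Zsqrtd.norm_def]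
      ring
    have hdot : 2 * dot z w = g.norm * (s ^ 2 - k ^ 2) := by
      have e : 2 * dot z w =
          (z.re + z.im) * (w.re + w.im) + (z.re - z.im) * (w.re - w.im) := by
        simp only [dot]; ring
      rw [e, h1, h2, h3, h4, Zsqrtd.norm_def]
      ring
    rw [← abs_two, ← abs_mul, abs_le] at hd
    -- By `hnorm` and `hdot`, the angle bound says `2 * |s ^ 2 - k ^ 2| ≤ s ^ 2 + k ^ 2` after
    -- division by `g.norm`.
    have hsk : s ^ 2 ≤ 3 * k ^ 2 := by
      refine le_of_mul_le_mul_left ?_ hg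
      linarith
    have hks : k ^ 2 ≤ 3 * s ^ 2 := by
      refine le_of_mul_le_mul_left ?_ hg
      linarith
    have hprod : s.natAbs * k.natAbs * g.norm.natAbs = p * q := by
      rw [← Int.natAbs_mul, ← Int.natAbs_mul, ← Int.natAbs_neg, ← harea]
      zify
      exact_mod_cast hu
    have hp3 : 3 ≤ p := by have := hp.two_le; obtain ⟨c, hc⟩ := hp2; lia
    have hcases := factorization_cases hp hq hp3 (hp3.trans hpq) hprod
      (by zify; simpa using hsk) (by zify; simpa using hks)
    have hone : g.norm.natAbs = 1 →
        Submodule.span ℤ {z, w} = diagonalLattice s.natAbs k.natAbs ∨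
        Submodule.span ℤ {z, w} = diagonalLattice k.natAbs s.natAbs := by
      intro hn1
      have hg1 : g.norm = 1 := by lia
      rw [diagonalLattice_natAbs, diagonalLattice_natAbs]
      refine (eq_diagonalLattice_of_norm_eq_one hs hk hg1 ?_ h1 h2 h3 h4).imp Eq.symm Eq.symm
      rw [harea, hg1, mul_one, abs_neg]
    rcases hcases with ⟨hs1, hk1, hn1⟩ | ⟨hs1, hk1, hn1⟩ | ⟨hs1, hk1, hn1⟩
    · left
      have hgn : g.norm = (p * q : ℕ) := by lia
      refine ⟨g, hgn, ?_⟩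
      refine (eq_principalLattice_of_abs_eq_one hs1 hk1 (GaussianInt.norm_pos.1 hg) ?_
        h1 h2 h3 h4).symm
      rw [hu, hgn, Nat.abs_cast]
    · right
      have := hone hn1
      rw [hs1, hk1] at this
      refine ⟨?_, this⟩
      rw [← hs1, ← hk1]
      zify; simpa using hks
    · right
      have := hone hn1
      rw [hs1, hk1] at this
      refine ⟨?_, this.symm⟩
      rw [← hs1, ← hk1]
      zify; simpa using hsk
  · rintro (⟨g, hg, rfl⟩ | ⟨h, rfl | rfl⟩)
    · exact hasEquilateralBasis_principalLattice hne hg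
    · exact hasEquilateralBasis_diagonalLattice hp2 hq2 hle h
    · rw [mul_comm]
      exact hasEquilateralBasis_diagonalLattice hq2 hp2 h hle

/-! ### Counting ideals of norm `p * q`. -/

theorem principalLattice_eq_iff {g h : GaussianInt} :
    principalLattice g = principalLattice h ↔ Associated g h := by
  rw [principalLattice, principalLattice, (Submodule.restrictScalars_injective ℤ _ _).eq_iff,
    Ideal.span_singleton_eq_span_singleton]

theorem associated_of_dvd_of_norm_eq {g h : GaussianInt} (hdvd : g ∣ h) (hn : g.norm = h.norm)
    (hg : g ≠ 0) : Associated g h := by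
  obtain ⟨c, rfl⟩ := hdvd
  have hc : c.norm = 1 := by
    rw [Zsqrtd.norm_mul] at hn
    exact mul_left_cancel₀ (GaussianInt.norm_pos.2 hg).ne' (by rw [mul_one]; exact hn.symm)
  exact (associated_mul_isUnit_right_iff ((Zsqrtd.norm_eq_one_iff' (by norm_num) c).1 hc)).2
    (Associated.refl g)

theorem norm_dvd_norm {g h : GaussianInt} (hdvd : g ∣ h) : g.norm ∣ h.norm := by
  obtain ⟨c, rfl⟩ := hdvd
  rw [Zsqrtd.norm_mul]
  exact dvd_mul_right _ _

theorem prime_of_norm_eq {p : ℕ} (hp : p.Prime) {g : GaussianInt} (hg : g.norm = p) :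
    Prime g := by
  refine Irreducible.prime ⟨?_, ?_⟩
  · intro h
    rw [← Zsqrtd.norm_eq_one_iff' (by norm_num), hg] at h
    exact hp.one_lt.ne' (by exact_mod_cast h)
  · rintro a b rfl
    rw [Zsqrtd.norm_mul] at hg
    have h : a.norm.natAbs * b.norm.natAbs = p := by
      rw [← Int.natAbs_mul, hg, Int.natAbs_natCast]
    rw [← Zsqrtd.norm_eq_one_iff, ← Zsqrtd.norm_eq_one_iff]
    rcases (Nat.dvd_prime hp).1 ⟨_, h.symm⟩ with h1 | h1
    · exact Or.inl h1
    · right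
      rw [h1] at h
      exact mul_left_cancel₀ hp.ne_zero (h.trans (mul_one p).symm)

/-- The prime `g` divides `p = h * star h`, hence `h` or its conjugate. -/
theorem associated_or_associated_star {p : ℕ} (hp : p.Prime) {g h : GaussianInt}
    (hg : g.norm = p) (hh : h.norm = p) : Associated g h ∨ Associated (star g) h := by
  have hg0 : g ≠ 0 := (prime_of_norm_eq hp hg).ne_zero
  have hdvd : g ∣ h * star h := by
    rw [← Zsqrtd.norm_eq_mul_conj, hh, ← hg, Zsqrtd.norm_eq_mul_conj]
    exact dvd_mul_right _ _
  rcases (prime_of_norm_eq hp hg).dvd_or_dvd hdvd with h1 | h1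
  · exact Or.inl (associated_of_dvd_of_norm_eq h1 (hg.trans hh.symm) hg0)
  · right
    obtain ⟨c, hc⟩ := h1
    refine associated_of_dvd_of_norm_eq ⟨star c, ?_⟩ (by rw [Zsqrtd.norm_conj, hg, hh])
      (star_ne_zero.2 hg0)
    rw [← star_star h, hc, star_mul']

/-- Otherwise `g` divides `g + star g = 2 * g.re`. Taking norms, `p` divides `g.re`, then `g.im`, so
`p ^ 2 ∣ g.norm = p`. -/
theorem not_associated_star {p : ℕ} (hp : p.Prime) (hodd : Odd p) {g : GaussianInt}
    (hg : g.norm = p) : ¬ Associated g (star g) := by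
  intro h
  have hdvd : g ∣ ⟨2 * g.re, 0⟩ := by
    have e : (⟨2 * g.re, 0⟩ : GaussianInt) = g + star g := by ext <;> simp; ring
    rw [e]
    exact dvd_add dvd_rfl h.dvd
  have hpI : Prime (p : ℤ) := Nat.prime_iff_prime_int.1 hp
  have h2 : ¬ (p : ℤ) ∣ 2 := by
    intro h
    have h3 : p ∣ 2 := by exact_mod_cast h
    rcases (Nat.dvd_prime Nat.prime_two).1 h3 with rfl | rfl
    · exact hp.one_lt.ne' rfl
    · exact absurd hodd (by decide)
  have h1 : (p : ℤ) ∣ (2 * g.re) * (2 * g.re) := by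
    have := norm_dvd_norm hdvd
    rw [hg] at this
    simpa [Zsqrtd.norm_def] using this
  have hre : (p : ℤ) ∣ g.re :=
    ((hpI.dvd_or_dvd h1).elim id id |> hpI.dvd_or_dvd).resolve_left h2
  rw [Zsqrtd.norm_def] at hg
  have him : (p : ℤ) ∣ g.im := by
    have h3 : (p : ℤ) ∣ g.im * g.im := by
      have e : g.im * g.im = p - g.re * g.re := by linarith
      rw [e]
      exact dvd_sub dvd_rfl (hre.mul_right _)
    exact (hpI.dvd_or_dvd h3).elim id id
  obtain ⟨a, ha⟩ := hre
  obtain ⟨b, hb⟩ := him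
  have h4 : (p : ℤ) * (p * (a * a + b * b)) = p * 1 := by
    rw [ha, hb] at hg
    linarith
  exact hpI.not_isUnit (IsUnit.of_mul_eq_one _ (mul_left_cancel₀ hpI.ne_zero h4))

theorem associated_of_associated_mul {p q : ℕ} (hp : p.Prime) (hq : q.Prime) (hpq : p ≠ q)
    {x x' y y' : GaussianInt} (hx : x.norm = p) (hx' : x'.norm = p) (hy : y.norm = q)
    (hy' : y'.norm = q) (h : Associated (x * y) (x' * y')) :
    Associated x x' ∧ Associated y y' := by
  have key : ∀ {p q : ℕ} {x x' y y' : GaussianInt}, p.Prime → q.Prime → p ≠ q → x.norm = p →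
      x'.norm = p → y'.norm = q → Associated (x * y) (x' * y') → Associated x x' := by
    intro p q x x' y y' hp hq hpq hx hx' hy' h
    have hxp := prime_of_norm_eq hp hx
    rcases hxp.dvd_or_dvd ((dvd_mul_right x y).trans h.dvd) with h1 | h1
    · exact associated_of_dvd_of_norm_eq h1 (hx.trans hx'.symm) hxp.ne_zero
    · have h2 := norm_dvd_norm h1
      rw [hx, hy'] at h2
      exact absurd ((Nat.prime_dvd_prime_iff_eq hp hq).1 (by exact_mod_cast h2)) hpq
  exact ⟨key hp hq hpq hx hx' hy' h,
    key hq hp hpq.symm hy hy' hx' (by rwa [mul_comm y x, mul_comm y' x'])⟩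

theorem exists_norm_eq {p : ℕ} (hp : p.Prime) (h : p % 4 = 1) :
    ∃ g : GaussianInt, g.norm = p := by
  have := Fact.mk hp
  obtain ⟨a, b, hab⟩ := Nat.Prime.sq_add_sq (p := p) (by lia)
  refine ⟨⟨a, b⟩, ?_⟩
  rw [← hab, Zsqrtd.norm_def]
  push_cast
  ring

/-- Such an `r` is inert: it divides `g` or `star g`, so `r ^ 2` divides the norm. -/
theorem norm_ne_of_mod_four_eq_three {r m : ℕ} (hr : r.Prime) (h : r % 4 = 3) (hm : ¬ r ∣ m)
    (g : GaussianInt) : g.norm ≠ (r * m : ℕ) := by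
  intro hg
  have := Fact.mk hr
  have hprime := GaussianInt.prime_of_nat_prime_of_mod_four_eq_three r h
  have hdvd : (r : GaussianInt) ∣ g * star g := by
    rw [← Zsqrtd.norm_eq_mul_conj, hg]
    push_cast
    exact dvd_mul_right _ _
  have h2 : (r : GaussianInt).norm ∣ g.norm := by
    rcases hprime.dvd_or_dvd hdvd with h1 | h1
    · exact norm_dvd_norm h1
    · rw [← Zsqrtd.norm_conj g]
      exact norm_dvd_norm h1
  rw [hg, Zsqrtd.norm_natCast] at h2
  exact hm (Nat.dvd_of_mul_dvd_mul_left hr.pos (by exact_mod_cast h2))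

theorem setOf_principalLattice_eq_empty {p q : ℕ} (hp : p.Prime) (hq : q.Prime) (hpq : p ≠ q)
    (h : p % 4 = 3 ∨ q % 4 = 3) :
    {M | ∃ g : GaussianInt, g.norm = (p * q : ℕ) ∧ M = principalLattice g} = ∅ := by
  rw [Set.eq_empty_iff_forall_notMem]
  rintro M ⟨g, hg, -⟩
  rcases h with h | h
  · exact norm_ne_of_mod_four_eq_three hp h
      (fun hd => hpq ((Nat.prime_dvd_prime_iff_eq hp hq).1 hd)) g hg
  · exact norm_ne_of_mod_four_eq_three hq h
      (fun hd => hpq ((Nat.prime_dvd_prime_iff_eq hq hp).1 hd).symm) g (by rw [hg, mul_comm])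

/-- Each prime splits into two non-associated conjugate factors, and a generator is a choice of one
factor over each prime. -/
theorem encard_setOf_principalLattice {p q : ℕ} (hp : p.Prime) (hq : q.Prime) (hp2 : Odd p)
    (hq2 : Odd q) (hpq : p ≠ q) (hp1 : p % 4 = 1) (hq1 : q % 4 = 1) :
    {M | ∃ g : GaussianInt, g.norm = (p * q : ℕ) ∧ M = principalLattice g}.encard = 4 := by
  obtain ⟨x, hx⟩ := exists_norm_eq hp hp1
  obtain ⟨y, hy⟩ := exists_norm_eq hq hq1
  have hx' : (star x).norm = p := by rw [Zsqrtd.norm_conj, hx]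
  have hy' : (star y).norm = q := by rw [Zsqrtd.norm_conj, hy]
  have hxx := not_associated_star hp hp2 hx
  have hyy := not_associated_star hq hq2 hy
  have hset : {M | ∃ g : GaussianInt, g.norm = (p * q : ℕ) ∧ M = principalLattice g} =
      {principalLattice (x * y), principalLattice (x * star y), principalLattice (star x * y),
        principalLattice (star x * star y)} := by
    ext M
    simp only [Set.mem_ofPred_eq, Set.mem_insert_iff, Set.mem_singleton_iff]
    constructor
    · rintro ⟨g, hg, rfl⟩
      have hdvd : x ∣ g * star g := by
        rw [← Zsqrtd.norm_eq_mul_conj, hg]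
        push_cast
        refine Dvd.dvd.mul_right ⟨star x, ?_⟩ _
        rw [← Zsqrtd.norm_eq_mul_conj, hx]
        simp
      have hfac : ∃ c, (g = x * c ∨ g = star x * c) ∧ c.norm = q := by
        have hcancel : ∀ {a c : GaussianInt}, a.norm = p → g = a * c → c.norm = q := by
          intro a c ha hgc
          rw [hgc, Zsqrtd.norm_mul, ha] at hg
          push_cast at hg
          exact mul_left_cancel₀ (by exact_mod_cast hp.ne_zero) hg
        rcases (prime_of_norm_eq hp hx).dvd_or_dvd hdvd with ⟨c, hc⟩ | ⟨c, hc⟩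
        · exact ⟨c, Or.inl hc, hcancel hx hc⟩
        · have hc' : g = star x * star c := by rw [← star_star g, hc, star_mul']
          exact ⟨star c, Or.inr hc', hcancel hx' hc'⟩
      obtain ⟨c, hgc, hc⟩ := hfac
      simp only [principalLattice_eq_iff]
      rcases hgc with rfl | rfl <;> rcases associated_or_associated_star hq hy hc with h | h
      · exact Or.inl (h.symm.mul_left _)
      · exact Or.inr (Or.inl (h.symm.mul_left _))
      · exact Or.inr (Or.inr (Or.inl (h.symm.mul_left _)))
      · exact Or.inr (Or.inr (Or.inr (h.symm.mul_left _)))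
    · rintro (rfl | rfl | rfl | rfl) <;>
        exact ⟨_, by rw [Zsqrtd.norm_mul]; simp only [hx, hx', hy, hy']; push_cast; rfl, rfl⟩
  have hassoc := @associated_of_associated_mul p q hp hq hpq
  rw [hset, Set.encard_insert_of_notMem, Set.encard_insert_of_notMem, Set.encard_pair]
  · norm_num
  · rw [Ne, principalLattice_eq_iff]
    exact fun h => hyy (hassoc hx' hx' hy hy' h).2
  · simp only [Set.mem_insert_iff, Set.mem_singleton_iff, principalLattice_eq_iff]
    rintro (h | h)
    · exact hxx (hassoc hx hx' hy' hy h).1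
    · exact hxx (hassoc hx hx' hy' hy' h).1
  · simp only [Set.mem_insert_iff, Set.mem_singleton_iff, principalLattice_eq_iff]
    rintro (h | h | h)
    · exact hyy (hassoc hx hx hy hy' h).2
    · exact hxx (hassoc hx hx' hy hy h).1
    · exact hxx (hassoc hx hx' hy hy' h).1

/-! ### Disjointness of the families and the final count. -/

theorem exists_mem_diagonalLattice {s k : ℤ} (hs : Odd s) (hk : Odd k) :
    ∃ v ∈ diagonalLattice s k, v.re + v.im = s ∧ v.re - v.im = k := by
  obtain ⟨f, hf⟩ := hs.add_odd hk
  have h1 : f + (s - f) = s := by ring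
  have h2 : f - (s - f) = k := by lia
  exact ⟨⟨f, s - f⟩, mem_diagonalLattice.2 ⟨dvd_of_eq h1.symm, dvd_of_eq h2.symm⟩, h1, h2⟩

/-- An ideal is stable under multiplication by `i`, which moves the value `x - y = k` to the
coordinate `x + y`, where `s` must divide it. -/
theorem dvd_of_diagonalLattice_eq_principalLattice {s k : ℤ} (hs : Odd s) (hk : Odd k)
    {g : GaussianInt} (h : diagonalLattice s k = principalLattice g) : s ∣ k := by
  obtain ⟨v, hv, -, h2⟩ := exists_mem_diagonalLattice hs hk
  have hmem : ⟨0, 1⟩ * v ∈ diagonalLattice s k := by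
    rw [h, mem_principalLattice] at hv ⊢
    exact hv.mul_left _
  have h3 := (mem_diagonalLattice.1 hmem).1
  have e : (⟨0, 1⟩ * v : GaussianInt).re + (⟨0, 1⟩ * v : GaussianInt).im = k := by
    rw [← h2]; simp; ring
  rwa [e] at h3

theorem dvd_of_diagonalLattice_eq_swap {s k : ℤ} (hs : Odd s) (hk : Odd k)
    (h : diagonalLattice s k = diagonalLattice k s) : k ∣ s := by
  obtain ⟨v, hv, h1, -⟩ := exists_mem_diagonalLattice hs hk
  rw [h] at hv
  exact h1 ▸ hv.1

theorem numWR_prime_mul_prime {p q : ℕ} (hp : p.Prime) (hq : q.Prime) (hp2 : Odd p)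
    (hq2 : Odd q) (hpq : p < q) :
    numWR (p * q) =
      {M | ∃ g : GaussianInt, g.norm = (p * q : ℕ) ∧ M = principalLattice g}.encard +
        if q ^ 2 ≤ 3 * p ^ 2 then 2 else 0 := by
  have hp' : Odd (p : ℤ) := by exact_mod_cast hp2
  have hq' : Odd (q : ℤ) := by exact_mod_cast hq2
  have hndvd : ¬ (p : ℤ) ∣ q := fun h =>
    hpq.ne ((Nat.prime_dvd_prime_iff_eq hp hq).1 (by exact_mod_cast h))
  have hndvd' : ¬ (q : ℤ) ∣ p := fun h =>
    hpq.ne' ((Nat.prime_dvd_prime_iff_eq hq hp).1 (by exact_mod_cast h))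
  rw [numWR_eq_encard (mul_ne_zero hp.ne_zero hq.ne_zero)]
  simp only [hasEquilateralBasis_prime_mul_prime_iff hp hq hp2 hq2 hpq.le]
  split_ifs with h
  · rw [← Set.encard_pair (fun e => hndvd' (dvd_of_diagonalLattice_eq_swap hp' hq' e)),
      ← Set.encard_union_eq]
    · simp only [h, true_and]; rfl
    · rw [Set.disjoint_left]
      rintro _ ⟨g, -, rfl⟩ (e | e)
      · exact hndvd (dvd_of_diagonalLattice_eq_principalLattice hp' hq' e.symm)
      · exact hndvd' (dvd_of_diagonalLattice_eq_principalLattice hq' hp' e.symm)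
  · simp only [h, false_and, or_false, add_zero]

theorem le_sqrt_three_mul_iff (p q : ℕ) : (q : ℝ) ≤ √3 * p ↔ q ^ 2 ≤ 3 * p ^ 2 := by
  rw [← sq_le_sq₀ (by positivity) (by positivity), mul_pow, Real.sq_sqrt (by norm_num)]
  exact_mod_cast Iff.rfl

end WellRounded

theorem mainTheorem8 (p₁ p₂ : ℕ) (hp₁ : p₁.Prime) (hp₂ : p₂.Prime)
    (hodd₁ : Odd p₁) (hodd₂ : Odd p₂) (hlt : p₁ < p₂) :
    ((p₁ % 4 = 3 ∨ p₂ % 4 = 3) → (p₂ : ℝ) > √3 * (p₁ : ℝ) →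
      WellRounded.numWR (p₁ * p₂) = 0) ∧
    ((p₁ % 4 = 3 ∨ p₂ % 4 = 3) → (p₂ : ℝ) ≤ √3 * (p₁ : ℝ) →
      WellRounded.numWR (p₁ * p₂) = 2) ∧
    ((p₁ % 4 = 1 ∧ p₂ % 4 = 1) → (p₂ : ℝ) > √3 * (p₁ : ℝ) →
      WellRounded.numWR (p₁ * p₂) = 4) ∧
    ((p₁ % 4 = 1 ∧ p₂ % 4 = 1) → (p₂ : ℝ) ≤ √3 * (p₁ : ℝ) →
      WellRounded.numWR (p₁ * p₂) = 6) := by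
  have hcount := WellRounded.numWR_prime_mul_prime hp₁ hp₂ hodd₁ hodd₂ hlt
  have hzero := WellRounded.setOf_principalLattice_eq_empty hp₁ hp₂ hlt.ne
  have hfour := WellRounded.encard_setOf_principalLattice hp₁ hp₂ hodd₁ hodd₂ hlt.ne
  refine ⟨fun h hgt => ?_, fun h hle => ?_, fun h hgt => ?_, fun h hle => ?_⟩
  · rw [gt_iff_lt, ← not_le, WellRounded.le_sqrt_three_mul_iff] at hgt
    rw [hcount, hzero h, if_neg hgt, Set.encard_empty, add_zero]
  · rw [WellRounded.le_sqrt_three_mul_iff] at hle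
    rw [hcount, hzero h, if_pos hle, Set.encard_empty, zero_add]
  · rw [gt_iff_lt, ← not_le, WellRounded.le_sqrt_three_mul_iff] at hgt
    rw [hcount, hfour h.1 h.2, if_neg hgt, add_zero]
  · rw [WellRounded.le_sqrt_three_mul_iff] at hle
    rw [hcount, hfour h.1 h.2, if_pos hle]
    norm_num
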